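/- Fix an even integer $M\ge 2$ and the set $\mathbb P=\{0,1,\dots,M\}$ of priorities. A parity game (PG) consists of a non-empty finite set $V$ of nodes, partitioned into the nodes $V_\exists$ of Player $\exists$ and $V_\forall$ of Player $\forall$, a set $E\subseteq V\times V$ of edges such that every node has a successor, and a labelling $\Omega\colon E\to\mathbb P$. An infinite path satisfies the parity condition if the largest priority that occurs on it infinitely often is even. Strategies may depend on the whole history of the play. A node $v$ is winning if some $\exists$-strategy is such that, against every $\forall$-strategy, the induced play from $v$ satisfies the parity condition. An open parity game (oPG) $\mathcal A$ is a PG together with four pairwise disjoint, totally ordered sets $I_{\mathbf r},I_{\mathbf l},O_{\mathbf r},O_{\mathbf l}\subseteq V_\exists$; the elements of $I=I_{\mathbf r}\cup I_{\mathbf l}$ are the entrances and those of $O=O_{\mathbf r}\cup O_{\mathbf l}$ the exits. The only edge that leaves an exit $o$ is the loop $(o,o)$, and $\Omega(o,o)=0$. Orders. The order $\preceq$ on $\mathbb P$ is $M-1\prec M-3\prec\dots\prec 1\prec 0\prec 2\prec\dots\prec M$. On $D=\{\bot,\top\}\cup(O\times\mathbb P)$, let $d_1\preceq d_2$ iff $d_1=\bot$,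 or $d_2=\top$, or $d_1=(o,m_1)$, $d_2=(o,m_2)$ with $m_1\preceq m_2$. For $T_1,T_2\subseteq D$, let $T_1\preceq_{\mathbf U}T_2$ iff every $d_2\in T_2$ has some $d_1\in T_1$ with $d_1\preceq d_2$. A result is a non-empty antichain of $D$. Pareto front. The denotation of a play on $\mathcal A$ is $(o,m)\in D$ if the play reaches the exit $o$ and $m$ is the largest priority seen before; if it reaches no exit, it is $\top$ or $\bot$ according to whether the parity condition holds or fails. For an entrance $i$ and an $\exists$-strategy $\sigma$, let $R_\sigma$ be the set of $\preceq$-minimal elements of the set of denotations of the plays from $i$ that are induced by $\sigma$ and some $\forall$-strategy. The Pareto front at $i$ is the set of $\preceq_{\mathbf U}$-maximal elements of $\{R_\sigma\mid\sigma\text{ an }\exists\text{-strategy}\}$. Its elements are called Pareto-optimal. Queries. A query is a function $q\colon O\to\mathbb P\uplus\{\bot\}$. Queries are ordered pointwise, with $\bot$ below every priority and priorities ordered by $\preceq$. The dual of a priority $m$ is $\overline m=m+1$ if $m$ is odd, $\overline 0=0$, and $\overline m=m-1$ if $m>0$ is even. The dual of $q$ is $\overline q=\{\top\}$ if $q(o)=\bot$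 for all $o\in O$, and $\overline q=\{(o,\overline{q(o)})\mid o\in O,\ q(o)\in\mathbb P\}$ otherwise. The loop construction $\mathcal A[i,q]$ is the PG obtained from $\mathcal A$ by replacing, for every exit $o$, the loop at $o$ by the edge $(o,i)$ with priority $q(o)$ if $q(o)\in\mathbb P$, and by the loop $(o,o)$ with priority $1$ if $q(o)=\bot$. **Statement.** Let $\mathcal A$ be an oPG, $i$ an entrance of $\mathcal A$ and $q$ a query. 1. The query $q$ is minimal among the queries $q'$ such that $i$ is winning in $\mathcal A[i,q']$ if and only if $\overline q$ belongs to the Pareto front at $i$. 2. The node $i$ is winning in $\mathcal A[i,q]$ if and only if there is a result $\mathbf r$ in the Pareto front at $i$ with $\overline q\preceq_{\mathbf U}\mathbf r$. -/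

import Mathlib

open Filter

/-- The finite set `{0, 1, ..., M}` of priorities. -/
abbrev Priority (M : ℕ) : Type := Fin (M + 1)

/-- The set of minimal elements of `T` with respect to a (pre)order `r`. -/
def minimalElems {α : Type*} (r : α → α → Prop) (T : Set α) : Set α :=
  {a | a ∈ T ∧ ∀ b ∈ T, r b a → r a b}

/-- The set of maximal elements of `T` with respect to a (pre)order `r`. -/
def maximalElems {α : Type*} (r : α → α → Prop) (T : Set α) : Set α :=
  {a | a ∈ T ∧ ∀ b ∈ T, r a b → r b a}

namespace Priority

/-- The rank of a priority: even `m` has rank `m`, odd `m` has rank `-m`. -/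
def rank {M : ℕ} (m : Priority M) : ℤ :=
  if Even m.val then (m.val : ℤ) else -(m.val : ℤ)

/-- The sub-priority order `M-1 < M-3 < ... < 1 < 0 < 2 < ... < M-2 < M`. -/
def subLE {M : ℕ} (m m' : Priority M) : Prop := rank m ≤ rank m'

/-- The dual of a priority: `m + 1` for `m` odd, `0` for `m = 0`, and `m - 1` for `m > 0` even.
It stays below `M` because `M` is even. -/
def dual {M : ℕ} (hM : Even M) (m : Priority M) : Priority M :=
  if hm : Even m.val then
    ⟨m.val - 1, lt_of_le_of_lt (Nat.sub_le _ _) m.isLt⟩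
  else
    ⟨m.val + 1, by
      have h1 : m.val < M + 1 := m.isLt
      have h2 : m.val ≠ M := fun h => hm (by rw [h]; exact hM)
      omega⟩

end Priority

/-! ### Parity games -/

/-- A parity game on the set `V` of nodes. Player `∃` owns the nodes of `existsNodes` and
Player `∀` owns all the others. The labelling matters on edges only. -/
structure ParityGame (V : Type*) (M : ℕ) where
  existsNodes : Set V
  edge : V → V → Prop
  prio : V → V → Priority M
  exists_succ : ∀ v, ∃ w, edge v w

namespace ParityGame

variable {V : Type*} {M : ℕ}

/-- An `∃`-strategy: `next h v` is the move made at the node `v` of Player `∃` after the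
history `h = v₁ ⋯ vₙ` (in chronological order, without `v`). Values at nodes of the other player
are never used. -/
structure ExistsStrategy (G : ParityGame V M) where
  next : List V → V → V
  legal : ∀ h v, v ∈ G.existsNodes → G.edge v (next h v)

/-- A `∀`-strategy. -/
structure ForallStrategy (G : ParityGame V M) where
  next : List V → V → V
  legal : ∀ h v, v ∉ G.existsNodes → G.edge v (next h v)

open Classical in
/-- One round of the game, on pairs (history, current node). -/
noncomputable def step (G : ParityGame V M) (σ : G.ExistsStrategy) (τ : G.ForallStrategy)
    (s : List V × V) : List V × V :=
  (s.1 ++ [s.2], if s.2 ∈ G.existsNodes then σ.next s.1 s.2 else τ.next s.1 s.2)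

/-- The (infinite) play from `v` induced by a pair of strategies. -/
noncomputable def play (G : ParityGame V M) (σ : G.ExistsStrategy) (τ : G.ForallStrategy)
    (v : V) (n : ℕ) : V :=
  ((G.step σ τ)^[n] ([], v)).2

/-- The parity condition: the maximum priority that occurs infinitely often is even. -/
def ParityCondition (G : ParityGame V M) (p : ℕ → V) : Prop :=
  ∃ m : Priority M, Even m.val ∧
    IsGreatest {m' : Priority M | ∃ᶠ n in atTop, G.prio (p n) (p (n + 1)) = m'} m

/-- The node `v` is winning (for Player `∃`): some `∃`-strategy wins all plays from `v`. -/
def Winning (G : ParityGame V M) (v : V) : Prop :=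
  ∃ σ : G.ExistsStrategy, ∀ τ : G.ForallStrategy, G.ParityCondition (G.play σ τ v)

end ParityGame

/-! ### Open parity games -/

/-- An open parity game. A finite totally ordered set of open ends is given as the list of its
elements in increasing order; `nodup` says that these lists have no repetitions and that the four
sets are pairwise disjoint. -/
structure OpenParityGame (V : Type*) (M : ℕ) extends ParityGame V M where
  entrancesR : List V
  entrancesL : List V
  exitsR : List V
  exitsL : List V
  nodup : (entrancesR ++ entrancesL ++ exitsR ++ exitsL).Nodup
  openEnds_exists : ∀ v ∈ entrancesR ++ entrancesL ++ exitsR ++ exitsL, v ∈ existsNodes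
  exits_sink : ∀ o ∈ exitsR ++ exitsL, ∀ v, edge o v → v = o ∧ prio o o = 0

/-- The elements `⊥`, `⊤` and `(o, m)` with `o` an exit and `m` a priority. -/
inductive Denotation (O : Type*) (M : ℕ) where
  | bot : Denotation O M
  | top : Denotation O M
  | exit (o : O) (m : Priority M) : Denotation O M

namespace Denotation

variable {O : Type*} {M : ℕ}

/-- The domain order. -/
def domLE (d₁ d₂ : Denotation O M) : Prop :=
  d₁ = bot ∨ d₂ = top ∨
    ∃ o m₁ m₂, d₁ = exit o m₁ ∧ d₂ = exit o m₂ ∧ Priority.subLE m₁ m₂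

/-- The upper preorder on sets. -/
def upperLE (T₁ T₂ : Set (Denotation O M)) : Prop :=
  ∀ d₂ ∈ T₂, ∃ d₁ ∈ T₁, domLE d₁ d₂

/-- The minimal elements of a set with respect to the domain order. -/
def worst (T : Set (Denotation O M)) : Set (Denotation O M) := minimalElems domLE T

/-- The maximal elements of a family of sets with respect to the upper preorder. -/
def best (S : Set (Set (Denotation O M))) : Set (Set (Denotation O M)) := maximalElems upperLE S

/-- Results: non-empty antichains of the domain. -/
def IsResult (r : Set (Denotation O M)) : Prop := r.Nonempty ∧ worst r = r

end Denotation

namespace OpenParityGame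

open Denotation

variable {V : Type*} {M : ℕ}

/-- The type of entrances. -/
def Entrance (A : OpenParityGame V M) : Type _ := {v : V // v ∈ A.entrancesR ++ A.entrancesL}

/-- The type of exits. -/
def Exit (A : OpenParityGame V M) : Type _ := {v : V // v ∈ A.exitsR ++ A.exitsL}

open Classical in
/-- The denotation of a play. If the play visits an exit, then `Nat.find h` is the first time at
which it does; from then on it stays there and sees only priority `0`. -/
noncomputable def denotation (A : OpenParityGame V M) (p : ℕ → V) : Denotation A.Exit M :=
  if h : ∃ j, p j ∈ A.exitsR ++ A.exitsL then
    exit ⟨p (Nat.find h), Nat.find_spec h⟩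
      ((Finset.range (Nat.find h)).sup fun k => A.prio (p k) (p (k + 1)))
  else if A.ParityCondition p then top
  else bot

/-- The denotations of the plays from `v` that are consistent with a given `∃`-strategy. -/
def outcomes (A : OpenParityGame V M) (v : V) (σ : A.ExistsStrategy) : Set (Denotation A.Exit M) :=
  {d | ∃ τ : A.ForallStrategy, d = A.denotation (A.play σ τ v)}

/-- The Pareto front at an entrance. -/
def paretoFront (A : OpenParityGame V M) (i : A.Entrance) : Set (Set (Denotation A.Exit M)) :=
  best {T | ∃ σ : A.ExistsStrategy, T = worst (A.outcomes i.1 σ)}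

/-- Queries: each exit is assigned a priority, or `⊥` (here `none`). -/
def Query (A : OpenParityGame V M) : Type _ := A.Exit → Option (Priority M)

/-- The order on priorities extended by the least element `⊥`. -/
def optLE : Option (Priority M) → Option (Priority M) → Prop
  | none, _ => True
  | some _, none => False
  | some m, some m' => Priority.subLE m m'

/-- The query order. -/
def queryLE (A : OpenParityGame V M) (q q' : A.Query) : Prop := ∀ o, optLE (q o) (q' o)

/-- The dual of a query. -/
def dualQuery (A : OpenParityGame V M) (hM : Even M) (q : A.Query) : Set (Denotation A.Exit M) :=
  {d | ((∀ o, q o = none) ∧ d = top) ∨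
    ∃ o m, q o = some m ∧ d = exit o (Priority.dual hM m)}

open Classical in
/-- The loop construction `A[i, q]`: the edges that leave an exit `o` are replaced by the single
edge from `o` to `i` with priority `q o`, or, if `q o = ⊥`, by a self-loop with priority `1`. -/
noncomputable def loop (A : OpenParityGame V M) (i : A.Entrance) (q : A.Query) :
    ParityGame V M where
  existsNodes := A.existsNodes
  edge v w :=
    if h : v ∈ A.exitsR ++ A.exitsL then
      match q ⟨v, h⟩ with
      | some _ => w = i.1
      | none => w = v
    else A.edge v w
  prio v w :=
    if h : v ∈ A.exitsR ++ A.exitsL then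
      match q ⟨v, h⟩ with
      | some m => m
      | none => 1
    else A.prio v w
  exists_succ v := by
    by_cases h : v ∈ A.exitsR ++ A.exitsL
    · cases hq : q ⟨v, h⟩ with
      | some m => exact ⟨i.1, by simp [h, hq]⟩
      | none => exact ⟨v, by simp [h, hq]⟩
    · obtain ⟨w, hw⟩ := A.exists_succ v
      exact ⟨w, by rw [dif_neg h]; exact hw⟩

/-- `q` is minimal, in the query order, among the queries for which `i` is winning in `A[i, q]`. -/
def IsMinimalWinningQuery (A : OpenParityGame V M) (i : A.Entrance) (q : A.Query) : Prop :=
  q ∈ minimalElems A.queryLE {q' : A.Query | (A.loop i q').Winning i.1}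

end OpenParityGame

/-! ### Minimal and maximal elements of finite preorders -/

/-! Everything reduces to one equivalence: `i` is winning in `A[i, q]` iff some `∃`-strategy of `A`
has all its denotations above the dual of `q`. A priority `m` is above the dual of `c` exactly when
`max m c` is even (`subLE_dual_iff_even_max`). So a play of `A` is above the dual of `q` iff either
it avoids the exits and satisfies the parity condition, or it reaches an exit with `q o ≠ ⊥` and,
closed by its return edge, has even maximum.

If all plays of a strategy are of this kind, restarting it after each exit wins the loop game
(`winning_loop_of_upperLE`). Conversely, if no strategy is, then for a winning strategy of the loop
game the residual after every history admits a bad play; chaining these plays refutes the winning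
strategy (`upperLE_of_winning_loop`). Neither determinacy nor positional strategies are needed.

The rest is order theory. The domain is finite, so taking minimal denotations and maximal results
loses nothing, which gives the second claim. Results without `⊥` are duals of queries and duality
reverses the orders, so minimal queries match maximal results. -/

theorem exists_mem_minimalElems {α : Type*} [Finite α] {r : α → α → Prop} (hr : ∀ a, r a a)
    (ht : ∀ a b c, r a b → r b c → r a c) {T : Set α} {a : α} (ha : a ∈ T) :
    ∃ b ∈ minimalElems r T, r b a := by
  let _ : Preorder α := { le := r, le_refl := hr, le_trans := ht }
  obtain ⟨b, hb, hm⟩ := (Set.toFinite T).exists_le_minimal ha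
  exact ⟨b, ⟨hm.prop, fun c hc hcb => hm.le_of_le hc hcb⟩, hb⟩

theorem exists_mem_maximalElems {α : Type*} [Finite α] {r : α → α → Prop} (hr : ∀ a, r a a)
    (ht : ∀ a b c, r a b → r b c → r a c) {T : Set α} {a : α} (ha : a ∈ T) :
    ∃ b ∈ maximalElems r T, r a b :=
  exists_mem_minimalElems (r := fun x y => r y x) hr (fun a b c h h' => ht c b a h' h) ha

/-! ### Priorities -/

namespace Priority

variable {M : ℕ}

theorem rank_injective : Function.Injective (rank (M := M)) := by
  intro m m' h
  apply Fin.ext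
  simp only [rank, Nat.even_iff] at h
  split_ifs at h <;> omega

theorem dual_val (hM : Even M) (m : Priority M) :
    (dual hM m).val = if m.val % 2 = 0 then m.val - 1 else m.val + 1 := by
  simp only [dual, Nat.even_iff]
  split_ifs <;> rfl

theorem dual_dual (hM : Even M) (m : Priority M) : dual hM (dual hM m) = m := by
  apply Fin.ext
  simp only [dual_val]
  split_ifs <;> omega

theorem subLE_dual_dual (hM : Even M) {m m' : Priority M} :
    subLE (dual hM m) (dual hM m') ↔ subLE m' m := by
  simp only [subLE, rank, Nat.even_iff, dual_val]
  split_ifs <;> omega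

/-- The dual of `c` is the least `m`, in the sub-priority order, for which `max m c` is even. -/
theorem subLE_dual_iff_even_max (hM : Even M) {c m : Priority M} :
    subLE (dual hM c) m ↔ Even (max m c).val := by
  rcases le_total m c with h | h
  · rw [max_eq_right h]
    have h' : m.val ≤ c.val := h
    simp only [subLE, rank, Nat.even_iff, dual_val]
    split_ifs <;> omega
  · rw [max_eq_left h]
    have h' : c.val ≤ m.val := h
    simp only [subLE, rank, Nat.even_iff, dual_val]
    split_ifs <;> omega

/-- The largest priority that occurs infinitely often in `c` is even. -/
def EvenLimsup (c : ℕ → Priority M) : Prop :=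
  ∃ m : Priority M, Even m.val ∧ IsGreatest {m' : Priority M | ∃ᶠ n in atTop, c n = m'} m

theorem exists_isGreatest_frequently (c : ℕ → Priority M) :
    ∃ m, IsGreatest {m' : Priority M | ∃ᶠ n in atTop, c n = m'} m := by
  have hne : {m' : Priority M | ∃ᶠ n in atTop, c n = m'}.Nonempty := by
    by_contra hne
    have h : ∀ m', ∀ᶠ n in atTop, c n ≠ m' := fun m' => by
      by_contra h
      exact hne ⟨m', h⟩
    obtain ⟨n, hn⟩ := (eventually_all.2 h).exists
    exact hn _ rfl
  obtain ⟨m, hm⟩ := (Set.toFinite _).exists_maximal hne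
  exact ⟨m, hm.prop, fun m' hm' => (le_total m' m).elim id fun h => hm.le_of_ge hm' h⟩

theorem evenLimsup_shift (c : ℕ → Priority M) (a : ℕ) :
    EvenLimsup (fun n => c (n + a)) ↔ EvenLimsup c := by
  have h : ∀ m', (∃ᶠ n in atTop, c (n + a) = m') ↔ ∃ᶠ n in atTop, c n = m' := fun m' => by
    conv_rhs => rw [← map_add_atTop_eq_nat a]
    exact Iff.rfl
  simp only [EvenLimsup, h]

/-- If infinitely many cuts divide `c` into segments, and the maximum of every segment has the
property `Q`, then so has the largest priority that occurs infinitely often. -/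
theorem limsup_of_segments {c : ℕ → Priority M} {cut : ℕ → Prop} {Q : Priority M → Prop}
    (hcut : ∃ᶠ n in atTop, cut n)
    (hseg : ∀ a e, a ≤ e → (∀ b, a = b + 1 → cut b) → cut e → (∀ k, a ≤ k → k < e → ¬ cut k) →
      ∀ m, (∀ k, a ≤ k → k ≤ e → c k ≤ m) → (∃ k, a ≤ k ∧ k ≤ e ∧ c k = m) → Q m)
    {m : Priority M} (hm : IsGreatest {m' : Priority M | ∃ᶠ n in atTop, c n = m'} m) : Q m := by
  classical
  have hle : ∀ᶠ n in atTop, c n ≤ m := by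
    have h : ∀ m', ∀ᶠ n in atTop, m < m' → c n ≠ m' := fun m' => by
      by_cases hlt : m < m'
      · have h : ¬ ∃ᶠ n in atTop, c n = m' := fun h => not_le.2 hlt (hm.2 h)
        filter_upwards [not_frequently.1 h] with n hn _ using hn
      · exact Eventually.of_forall fun n h => absurd h hlt
    filter_upwards [eventually_all.2 h] with n hn
    by_contra hlt
    exact hn _ (not_le.1 hlt) rfl
  obtain ⟨N, hN⟩ := eventually_atTop.1 hle
  obtain ⟨r, hrN, hr⟩ := frequently_atTop.1 hcut N
  obtain ⟨n, hnr, hn⟩ := frequently_atTop.1 hm.1 (r + 1)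
  have hex : ∃ e, n ≤ e ∧ cut e := frequently_atTop.1 hcut n
  -- The segment around `n` runs from just after the last cut before `n` to the first cut at or
  -- after `n`. Since `b ≥ r ≥ N`, no value on it exceeds `m`.
  obtain ⟨b, hb⟩ : ∃ b, b = Nat.findGreatest cut (n - 1) := ⟨_, rfl⟩
  have hrn : r ≤ n - 1 := by omega
  have hrb : r ≤ b := hb ▸ Nat.le_findGreatest hrn hr
  have hbn : b ≤ n - 1 := hb ▸ Nat.findGreatest_le _
  refine hseg (b + 1) (Nat.find hex) ?_ ?_ (Nat.find_spec hex).2 ?_ m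
    (fun k hk _ => hN k (by omega)) ⟨n, by omega, (Nat.find_spec hex).1, hn⟩
  · have := (Nat.find_spec hex).1
    omega
  · intro b' hb'
    obtain rfl : b = b' := by omega
    rw [hb]
    exact Nat.findGreatest_spec hrn hr
  · intro k hk hke hc
    by_cases hkn : n ≤ k
    · exact Nat.find_min hex hke ⟨hkn, hc⟩
    · exact Nat.findGreatest_is_greatest (hb ▸ (by omega : b < k)) (by omega) hc

end Priority

/-! ### Plays -/

namespace ParityGame

variable {V : Type*} {M : ℕ}

/-- The sequence `p` is a play from `v` that is consistent with the `∃`-strategy `σ`. -/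
structure IsPlay (G : ParityGame V M) (σ : G.ExistsStrategy) (v : V) (p : ℕ → V) : Prop where
  start : p 0 = v
  edge : ∀ n, G.edge (p n) (p (n + 1))
  next : ∀ n, p n ∈ G.existsNodes → p (n + 1) = σ.next ((List.range n).map p) (p n)

theorem iterate_step (G : ParityGame V M) (σ : G.ExistsStrategy) (τ : G.ForallStrategy) (v : V)
    (n : ℕ) : (G.step σ τ)^[n] ([], v) = ((List.range n).map (G.play σ τ v), G.play σ τ v n) := by
  refine Prod.ext ?_ rfl
  induction n with
  | zero => rfl
  | succ n ih =>
    have ih' : ((G.step σ τ)^[n] ([], v)).1 = (List.range n).map (G.play σ τ v) := ih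
    rw [Function.iterate_succ_apply', List.range_succ, List.map_append, ← ih']
    rfl

open Classical in
theorem play_succ (G : ParityGame V M) (σ : G.ExistsStrategy) (τ : G.ForallStrategy) (v : V)
    (n : ℕ) : G.play σ τ v (n + 1) =
      if G.play σ τ v n ∈ G.existsNodes
      then σ.next ((List.range n).map (G.play σ τ v)) (G.play σ τ v n)
      else τ.next ((List.range n).map (G.play σ τ v)) (G.play σ τ v n) := by
  conv_lhs => rw [play, Function.iterate_succ_apply', iterate_step]
  rfl

theorem isPlay_play (G : ParityGame V M) (σ : G.ExistsStrategy) (τ : G.ForallStrategy) (v : V) :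
    G.IsPlay σ v (G.play σ τ v) := by
  refine ⟨rfl, fun n => ?_, fun n hn => ?_⟩
  · rw [play_succ]
    split_ifs with h
    · exact σ.legal _ _ h
    · exact τ.legal _ _ h
  · rw [play_succ, if_pos hn]

/-- The `∀`-strategy reads the time off the length of the history and copies `p`; the fallback `f`
only ensures legality away from `p`. -/
theorem IsPlay.exists_eq_play {G : ParityGame V M} {σ : G.ExistsStrategy} {v : V} {p : ℕ → V}
    (hp : G.IsPlay σ v p) : ∃ τ : G.ForallStrategy, G.play σ τ v = p := by
  classical
  choose f hf using G.exists_succ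
  let τ : G.ForallStrategy :=
    { next := fun h w => if G.edge w (p (h.length + 1)) then p (h.length + 1) else f w
      legal := fun h w _ => by
        split_ifs with hw
        · exact hw
        · exact hf w }
  refine ⟨τ, funext fun n => ?_⟩
  induction n using Nat.strong_induction_on with
  | _ n ih =>
    cases n with
    | zero => exact hp.start.symm
    | succ n =>
      have hmap : (List.range n).map (G.play σ τ v) = (List.range n).map p :=
        List.map_congr_left fun k hk => ih k (by have := List.mem_range.1 hk; omega)
      rw [play_succ, hmap, ih n (Nat.lt_succ_self n)]
      split_ifs with h
      · exact (hp.next n h).symm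
      · simp [τ, hp.edge n]

theorem winning_iff {G : ParityGame V M} {v : V} :
    G.Winning v ↔ ∃ σ : G.ExistsStrategy, ∀ p, G.IsPlay σ v p → G.ParityCondition p := by
  refine exists_congr fun σ => ⟨fun h p hp => ?_, fun h τ => h _ (G.isPlay_play σ τ v)⟩
  obtain ⟨τ, rfl⟩ := hp.exists_eq_play
  exact h τ

theorem nonempty_forallStrategy (G : ParityGame V M) : Nonempty G.ForallStrategy := by
  choose f hf using G.exists_succ
  exact ⟨⟨fun _ => f, fun _ v _ => hf v⟩⟩

/-- The parity condition depends only on the priorities seen from some time on. -/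
theorem parityCondition_congr {G G' : ParityGame V M} {p p' : ℕ → V} (a a' : ℕ)
    (h : ∀ n, G.prio (p (n + a)) (p (n + a + 1)) = G'.prio (p' (n + a')) (p' (n + a' + 1))) :
    G.ParityCondition p ↔ G'.ParityCondition p' := by
  have h1 := Priority.evenLimsup_shift (fun n => G.prio (p n) (p (n + 1))) a
  have h2 := Priority.evenLimsup_shift (fun n => G'.prio (p' n) (p' (n + 1))) a'
  simp only [h] at h1
  exact h1.symm.trans h2

end ParityGame

/-! ### Denotations -/

namespace Denotation

variable {O : Type*} {M : ℕ}

instance [Finite O] : Finite (Denotation O M) := by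
  refine Finite.of_surjective
    (fun x : Option (Option (O × Priority M)) => match x with
      | none => bot
      | some none => top
      | some (some (o, m)) => exit o m) ?_
  rintro (_ | _ | ⟨o, m⟩)
  exacts [⟨none, rfl⟩, ⟨some none, rfl⟩, ⟨some (some (o, m)), rfl⟩]

theorem domLE_exit_exit {o o' : O} {m m' : Priority M} :
    domLE (exit o m) (exit o' m') ↔ o = o' ∧ Priority.subLE m m' := by
  constructor
  · rintro (h | h | ⟨o, m₁, m₂, h₁, h₂, h⟩)
    · cases h
    · cases h
    · cases h₁
      cases h₂
      exact ⟨rfl, h⟩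
  · rintro ⟨rfl, h⟩
    exact Or.inr (Or.inr ⟨o, m, m', rfl, rfl, h⟩)

theorem not_domLE_top_exit {o : O} {m : Priority M} : ¬ domLE top (exit o m) := by
  rintro (h | h | ⟨o, m₁, m₂, h₁, -, -⟩)
  · cases h
  · cases h
  · cases h₁

theorem domLE_bot_iff {d : Denotation O M} : domLE d bot ↔ d = bot := by
  constructor
  · rintro (h | h | ⟨o, m₁, m₂, -, h₂, -⟩)
    · exact h
    · cases h
    · cases h₂
  · exact Or.inl

theorem domLE_top (d : Denotation O M) : domLE d top := Or.inr (Or.inl rfl)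

theorem bot_domLE (d : Denotation O M) : domLE bot d := Or.inl rfl

theorem domLE_refl (d : Denotation O M) : domLE d d := by
  cases d with
  | bot => exact bot_domLE _
  | top => exact domLE_top _
  | exit o m => exact domLE_exit_exit.2 ⟨rfl, le_refl (Priority.rank m)⟩

theorem domLE_trans (a b c : Denotation O M) (hab : domLE a b) (hbc : domLE b c) : domLE a c := by
  rcases hab with rfl | rfl | ⟨o, m₁, m₂, rfl, rfl, h⟩
  · exact bot_domLE _
  · rcases hbc with h | rfl | ⟨o, m₁, m₂, h, -, -⟩
    · cases h
    · exact domLE_top _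
    · cases h
  · rcases hbc with h' | rfl | ⟨o, m₁, m₃, h₁, rfl, h'⟩
    · cases h'
    · exact domLE_top _
    · cases h₁
      exact domLE_exit_exit.2 ⟨rfl, le_trans (α := ℤ) h h'⟩

theorem upperLE_refl (T : Set (Denotation O M)) : upperLE T T := fun d hd => ⟨d, hd, domLE_refl d⟩

theorem upperLE_trans (T₁ T₂ T₃ : Set (Denotation O M)) (h : upperLE T₁ T₂) (h' : upperLE T₂ T₃) :
    upperLE T₁ T₃ := fun d₃ hd₃ => by
  obtain ⟨d₂, hd₂, h₂₃⟩ := h' d₃ hd₃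
  obtain ⟨d₁, hd₁, h₁₂⟩ := h d₂ hd₂
  exact ⟨d₁, hd₁, domLE_trans _ _ _ h₁₂ h₂₃⟩

/-- By finiteness every element of `T` lies above a minimal one. -/
theorem upperLE_worst_iff [Finite O] {S T : Set (Denotation O M)} :
    upperLE S (worst T) ↔ upperLE S T := by
  refine ⟨fun h => upperLE_trans _ _ _ h fun d hd => ?_, fun h d hd => h d hd.1⟩
  exact exists_mem_minimalElems domLE_refl domLE_trans hd

theorem isResult_worst [Finite O] {T : Set (Denotation O M)} (hT : T.Nonempty) :
    IsResult (worst T) := by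
  obtain ⟨d, hd⟩ := hT
  obtain ⟨b, hb, -⟩ := exists_mem_minimalElems domLE_refl domLE_trans hd
  exact ⟨⟨b, hb⟩, Set.ext fun a =>
    ⟨fun ha => ha.1, fun ha => ⟨ha, fun b hb => ha.2 b hb.1⟩⟩⟩

theorem IsResult.domLE_symm {r : Set (Denotation O M)} (hr : IsResult r) {a b : Denotation O M}
    (ha : a ∈ r) (hb : b ∈ r) (h : domLE a b) : domLE b a := by
  rw [← hr.2] at hb
  exact hb.2 a ha h

end Denotation

/-! ### Queries and the loop construction -/

namespace OpenParityGame

open Denotation ParityGame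

variable {V : Type*} {M : ℕ} {A : OpenParityGame V M}

instance [Finite V] : Finite A.Exit := inferInstanceAs (Finite {v : V // v ∈ A.exitsR ++ A.exitsL})

theorem dualQuery_nonempty (hM : Even M) (q : A.Query) : (A.dualQuery hM q).Nonempty := by
  by_cases h : ∀ o, q o = none
  · exact ⟨top, Or.inl ⟨h, rfl⟩⟩
  · push Not at h
    obtain ⟨o, ho⟩ := h
    obtain ⟨m, hm⟩ := Option.ne_none_iff_exists'.1 ho
    exact ⟨_, Or.inr ⟨o, m, hm, rfl⟩⟩

theorem exists_dualQuery_domLE_top (hM : Even M) (q : A.Query) :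
    ∃ d ∈ A.dualQuery hM q, domLE d top :=
  (dualQuery_nonempty hM q).imp fun d hd => ⟨hd, domLE_top d⟩

theorem not_exists_dualQuery_domLE_bot (hM : Even M) (q : A.Query) :
    ¬ ∃ d ∈ A.dualQuery hM q, domLE d bot := by
  rintro ⟨d, hd, hb⟩
  rw [domLE_bot_iff] at hb
  subst hb
  rcases hd with ⟨-, h⟩ | ⟨_, _, -, h⟩ <;> cases h

theorem exists_dualQuery_domLE_exit (hM : Even M) (q : A.Query) {o : A.Exit} {m : Priority M} :
    (∃ d ∈ A.dualQuery hM q, domLE d (exit o m)) ↔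
      ∃ c, q o = some c ∧ Priority.subLE (Priority.dual hM c) m := by
  constructor
  · rintro ⟨d, ⟨-, rfl⟩ | ⟨o', c, hc, rfl⟩, h⟩
    · exact absurd h not_domLE_top_exit
    · obtain rfl := (domLE_exit_exit.1 h).1
      exact ⟨c, hc, (domLE_exit_exit.1 h).2⟩
  · rintro ⟨c, hc, h⟩
    exact ⟨_, Or.inr ⟨o, c, hc, rfl⟩, domLE_exit_exit.2 ⟨rfl, h⟩⟩

theorem upperLE_dualQuery_iff (hM : Even M) {q q' : A.Query} :
    upperLE (A.dualQuery hM q) (A.dualQuery hM q') ↔ A.queryLE q' q := by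
  constructor
  · intro h o
    cases hm' : q' o with
    | none => trivial
    | some m' =>
      obtain ⟨c, hc, hle⟩ := (exists_dualQuery_domLE_exit hM q).1 (h _ (Or.inr ⟨o, m', hm', rfl⟩))
      rw [hc]
      exact (Priority.subLE_dual_dual hM).1 hle
  · rintro h d (⟨-, rfl⟩ | ⟨o, m', hm', rfl⟩)
    · exact exists_dualQuery_domLE_top hM q
    · rw [exists_dualQuery_domLE_exit]
      have ho := h o
      rw [hm'] at ho
      cases hm : q o with
      | none =>
        rw [hm] at ho
        exact ho.elim
      | some m =>
        rw [hm] at ho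
        exact ⟨m, rfl, (Priority.subLE_dual_dual hM).2 ho⟩

theorem queryLE_antisymm {q q' : A.Query} (h : A.queryLE q q') (h' : A.queryLE q' q) : q = q' := by
  funext o
  have h₁ := h o
  have h₂ := h' o
  cases hq : q o <;> cases hq' : q' o <;> rw [hq, hq'] at h₁ h₂
  · exact h₂.elim
  · exact h₁.elim
  · exact congrArg some (Priority.rank_injective (le_antisymm (α := ℤ) h₁ h₂))

/-- Every result other than `{⊥}` is the dual of a query. -/
theorem exists_dualQuery_eq (hM : Even M) {r : Set (Denotation A.Exit M)} (hr : IsResult r)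
    (hbot : bot ∉ r) : ∃ q : A.Query, A.dualQuery hM q = r := by
  classical
  refine ⟨fun o => if h : ∃ m, exit o m ∈ r then some (Priority.dual hM h.choose) else none, ?_⟩
  -- Priorities at one exit are pairwise comparable, so an antichain contains at most one of them
  -- and `choose` has no freedom.
  have huniq : ∀ {o m m'}, exit o m ∈ r → exit o m' ∈ r → m = m' := by
    have key : ∀ {o m m'}, exit o m ∈ r → exit o m' ∈ r → Priority.subLE m m' → m = m' := by
      intro o m m' h h' hle
      have hle' := domLE_exit_exit.1 (hr.domLE_symm h h' (domLE_exit_exit.2 ⟨rfl, hle⟩))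
      exact Priority.rank_injective (le_antisymm (α := ℤ) hle hle'.2)
    intro o m m' h h'
    rcases le_total (Priority.rank m) (Priority.rank m') with hle | hle
    · exact key h h' hle
    · exact (key h' h hle).symm
  ext d
  constructor
  · rintro (⟨hall, rfl⟩ | ⟨o, m, hm, rfl⟩)
    · obtain ⟨d, hd⟩ := hr.1
      cases d with
      | bot => exact absurd hd hbot
      | top => exact hd
      | exit o m => simpa [show ∃ m, exit o m ∈ r from ⟨m, hd⟩] using hall o
    · dsimp only at hm
      split_ifs at hm with h
      cases hm
      rw [Priority.dual_dual]
      exact h.choose_spec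
  · intro hd
    cases d with
    | bot => exact absurd hd hbot
    | top =>
      refine Or.inl ⟨fun o => dif_neg ?_, rfl⟩
      rintro ⟨m, hm⟩
      exact not_domLE_top_exit (hr.domLE_symm hm hd (domLE_top _))
    | exit o m =>
      have h : ∃ m, exit o m ∈ r := ⟨m, hd⟩
      refine Or.inr ⟨o, _, dif_pos h, ?_⟩
      rw [Priority.dual_dual, huniq hd h.choose_spec]

section Loop

variable {i : A.Entrance} {q : A.Query} {v w : V}

theorem loop_edge_of_notMem (h : v ∉ A.exitsR ++ A.exitsL) :
    (A.loop i q).edge v w ↔ A.edge v w := by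
  simp only [loop, dif_neg h]

theorem loop_edge_of_some (h : v ∈ A.exitsR ++ A.exitsL) {c : Priority M}
    (hc : q ⟨v, h⟩ = some c) : (A.loop i q).edge v w ↔ w = i.1 := by
  simp only [loop, dif_pos h, hc]

theorem loop_edge_of_none (h : v ∈ A.exitsR ++ A.exitsL) (hc : q ⟨v, h⟩ = none) :
    (A.loop i q).edge v w ↔ w = v := by
  simp only [loop, dif_pos h, hc]

theorem loop_prio_of_notMem (h : v ∉ A.exitsR ++ A.exitsL) :
    (A.loop i q).prio v w = A.prio v w := by
  simp only [loop, dif_neg h]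

theorem loop_prio_of_some (h : v ∈ A.exitsR ++ A.exitsL) {c : Priority M}
    (hc : q ⟨v, h⟩ = some c) : (A.loop i q).prio v w = c := by
  simp only [loop, dif_pos h, hc]

theorem loop_prio_of_none (h : v ∈ A.exitsR ++ A.exitsL) (hc : q ⟨v, h⟩ = none) :
    (A.loop i q).prio v w = 1 := by
  simp only [loop, dif_pos h, hc]

theorem edge_exit (h : v ∈ A.exitsR ++ A.exitsL) : A.edge v v := by
  obtain ⟨w, hw⟩ := A.exists_succ v
  rwa [(A.exits_sink v h w hw).1] at hw

end Loop

/-- The denotation of the play `p` of `A` is above the dual of `q`. -/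
def AboveDual (A : OpenParityGame V M) (hM : Even M) (q : A.Query) (p : ℕ → V) : Prop :=
  ∃ d ∈ A.dualQuery hM q, domLE d (A.denotation p)

theorem upperLE_outcomes_iff {hM : Even M} {q : A.Query} {v : V} {σ : A.ExistsStrategy} :
    upperLE (A.dualQuery hM q) (A.outcomes v σ) ↔
      ∀ p, A.IsPlay σ v p → A.AboveDual hM q p := by
  constructor
  · intro h p hp
    obtain ⟨τ, rfl⟩ := hp.exists_eq_play
    exact h _ ⟨τ, rfl⟩
  · rintro h d ⟨τ, rfl⟩
    exact h _ (A.isPlay_play σ τ v)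

theorem aboveDual_iff_of_forall_notMem {hM : Even M} {q : A.Query} {p : ℕ → V}
    (h : ∀ j, p j ∉ A.exitsR ++ A.exitsL) : A.AboveDual hM q p ↔ A.ParityCondition p := by
  have hex : ¬ ∃ j, p j ∈ A.exitsR ++ A.exitsL := not_exists.2 h
  by_cases hp : A.ParityCondition p
  · rw [AboveDual, denotation, dif_neg hex, if_pos hp]
    exact iff_of_true (exists_dualQuery_domLE_top hM q) hp
  · rw [AboveDual, denotation, dif_neg hex, if_neg hp]
    exact iff_of_false (not_exists_dualQuery_domLE_bot hM q) hp

theorem aboveDual_iff_of_first {hM : Even M} {q : A.Query} {p : ℕ → V} {j : ℕ}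
    (hj : p j ∈ A.exitsR ++ A.exitsL) (hlt : ∀ k < j, p k ∉ A.exitsR ++ A.exitsL) :
    A.AboveDual hM q p ↔ ∃ c, q ⟨p j, hj⟩ = some c ∧
      Even (max ((Finset.range j).sup fun k => A.prio (p k) (p (k + 1))) c).val := by
  classical
  have h : ∃ j, p j ∈ A.exitsR ++ A.exitsL := ⟨j, hj⟩
  have hfind : Nat.find h = j := (Nat.find_eq_iff h).2 ⟨hj, hlt⟩
  subst hfind
  rw [AboveDual, denotation, dif_pos h]
  refine (exists_dualQuery_domLE_exit hM q).trans ?_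
  simp only [Priority.subLE_dual_iff_even_max]

/-- Here `x` lists the priorities inside a segment and `c` is that of its closing edge; the
hypotheses have the form supplied by `Priority.limsup_of_segments`. -/
theorem eq_max_of_segment {x : ℕ → Priority M} {j : ℕ} {c m : Priority M}
    (hle : ∀ k < j, x k ≤ m) (hc : c ≤ m) (hex : (∃ k < j, x k = m) ∨ c = m) :
    m = max ((Finset.range j).sup x) c := by
  apply le_antisymm
  · rcases hex with ⟨k, hk, rfl⟩ | rfl
    · exact le_max_of_le_left (Finset.le_sup (f := x) (Finset.mem_range.2 hk))
    · exact le_max_right _ _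
  · exact max_le (Finset.sup_le fun k hk => hle k (Finset.mem_range.1 hk)) hc

/-! ### From the open game to the loop construction -/

open Classical in
/-- The `∃`-strategy in the loop construction that restarts `σ` after each exit. -/
noncomputable def restart (i : A.Entrance) (q : A.Query) (σ : A.ExistsStrategy) :
    (A.loop i q).ExistsStrategy where
  next h v :=
    if v ∈ A.exitsR ++ A.exitsL then ((A.loop i q).exists_succ v).choose
    else σ.next (h.rtakeWhile fun w => w ∉ A.exitsR ++ A.exitsL) v
  legal h v hv := by
    split_ifs with hx
    · exact ((A.loop i q).exists_succ v).choose_spec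
    · rw [loop_edge_of_notMem hx]
      exact σ.legal _ _ hv

/-- Reading backwards stops exactly at position `a`, which is `0` or follows a node violating `P`.
For `restart` this recovers the history of the current segment. -/
theorem rtakeWhile_map_range {p : ℕ → V} {P : V → Prop} [DecidablePred P] {a : ℕ} (ha : ∀ b, a = b + 1 → ¬ P (p b))
    (t : ℕ) (ht : ∀ k < t, P (p (a + k))) :
    ((List.range (a + t)).map p).rtakeWhile (fun w => P w) =
      (List.range t).map fun k => p (a + k) := by
  induction t with
  | zero =>
    cases a with
    | zero => rfl
    | succ b =>
      rw [Nat.add_zero, List.range_succ, List.map_append, List.map_singleton,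
        List.rtakeWhile_concat_neg _ _ _ (by simpa using ha b rfl)]
      rfl
  | succ t ih =>
    rw [← Nat.add_assoc, List.range_succ, List.map_append, List.map_singleton,
      List.rtakeWhile_concat_pos _ _ _ (by simpa using ht t (Nat.lt_succ_self t)),
      ih fun k hk => ht k (by omega), List.range_succ, List.map_append, List.map_singleton]

open Classical in
/-- A segment of a play of the loop construction, stopped at the first exit, is a play of `A`. -/
theorem isPlay_segment {i : A.Entrance} {q : A.Query} {σ : A.ExistsStrategy} {p : ℕ → V}
    (hp : (A.loop i q).IsPlay (restart i q σ) i.1 p) {a : ℕ} (hpa : p a = i.1)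
    (ha : ∀ b, a = b + 1 → p b ∈ A.exitsR ++ A.exitsL) {f : ℕ → ℕ} (hf0 : f 0 = 0)
    (hf : ∀ k, (f k = k ∧ f (k + 1) = k + 1 ∧ ∀ l ≤ k, p (a + l) ∉ A.exitsR ++ A.exitsL) ∨
      (f (k + 1) = f k ∧ p (a + f k) ∈ A.exitsR ++ A.exitsL)) :
    A.IsPlay σ i.1 fun k => p (a + f k) := by
  refine ⟨by simpa [hf0] using hpa, fun k => ?_, fun k hk => ?_⟩
  · rcases hf k with ⟨h₁, h₂, h₃⟩ | ⟨h₁, h₂⟩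
    · have := hp.edge (a + k)
      rw [loop_edge_of_notMem (h₃ k le_rfl)] at this
      simpa only [h₁, h₂, Nat.add_assoc] using this
    · simp only [h₁]
      exact edge_exit h₂
  · rcases hf k with ⟨h₁, h₂, h₃⟩ | ⟨h₁, h₂⟩
    -- Before the first exit `f` cannot have stalled, so the histories in both games agree.
    · have hfl : ∀ l ≤ k, f l = l := by
        intro l hl
        induction l with
        | zero => exact hf0
        | succ l ih =>
          rcases hf l with ⟨-, h, -⟩ | ⟨-, h⟩
          · exact h
          · rw [ih (by omega)] at h
            exact absurd h (h₃ l (by omega))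
      have hmap : (List.range k).map (fun l => p (a + f l)) =
          (List.range k).map fun l => p (a + l) :=
        List.map_congr_left fun l hl => by
          rw [hfl l (List.mem_range.1 hl).le]
      simp only [h₁] at hk
      have := hp.next (a + k) hk
      rw [restart] at this
      simp only [if_neg (h₃ k le_rfl)] at this
      rw [rtakeWhile_map_range (P := fun w => w ∉ A.exitsR ++ A.exitsL)
        (fun b hb => not_not.2 (ha b hb)) k (fun l hl => h₃ l hl.le)] at this
      simp only [h₁, h₂]
      rw [hmap]
      exact this
    · simp only [h₁]
      exact ((A.exits_sink _ h₂ _ (σ.legal _ _ hk)).1).symm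

theorem winning_loop_of_upperLE {hM : Even M} {i : A.Entrance} {q : A.Query}
    {σ : A.ExistsStrategy} (hσ : upperLE (A.dualQuery hM q) (A.outcomes i.1 σ)) :
    (A.loop i q).Winning i.1 := by
  classical
  rw [upperLE_outcomes_iff] at hσ
  refine winning_iff.2 ⟨restart i q σ, fun p hp => ?_⟩
  have segment : ∀ a e, a ≤ e → p a = i.1 → (∀ b, a = b + 1 → p b ∈ A.exitsR ++ A.exitsL) →
      ∀ he : p e ∈ A.exitsR ++ A.exitsL,
      (∀ k, a ≤ k → k < e → p k ∉ A.exitsR ++ A.exitsL) → ∃ c, q ⟨p e, he⟩ = some c ∧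
        Even (max ((Finset.range (e - a)).sup
          fun k => (A.loop i q).prio (p (a + k)) (p (a + k + 1))) c).val := by
    intro a e hae hpa ha he hlt
    obtain ⟨j, rfl⟩ := Nat.exists_eq_add_of_le hae
    rw [Nat.add_sub_cancel_left]
    -- The `min` freezes the play at the exit, as the loop there does in `A`.
    have hplay : A.IsPlay σ i.1 fun k => p (a + min k j) := by
      refine isPlay_segment hp hpa ha (by simp) fun k => ?_
      by_cases hk : k < j
      · exact Or.inl ⟨by omega, by omega, fun l hl => hlt _ (by omega) (by omega)⟩
      · right
        rw [min_eq_right (by omega), min_eq_right (by omega)]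
        exact ⟨rfl, he⟩
    have hmin : ∀ k < j, p (a + min k j) ∉ A.exitsR ++ A.exitsL := fun k hk =>
      hlt _ (by omega) (by omega)
    have hj : p (a + min j j) ∈ A.exitsR ++ A.exitsL := by simpa using he
    obtain ⟨c, hc, hev⟩ := (aboveDual_iff_of_first (p := fun k => p (a + min k j)) hj hmin).1
      (hσ _ hplay)
    simp only [min_self] at hc
    refine ⟨c, hc, ?_⟩
    convert hev using 3
    refine Finset.sup_congr rfl fun k hk => ?_
    have hk := Finset.mem_range.1 hk
    rw [loop_prio_of_notMem (hlt _ (by omega) (by omega)), min_eq_left hk.le, min_eq_left hk]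
    rfl
  -- By strong induction, the preceding segment starts at `i`; `segment` then shows that its exit
  -- has `q ≠ ⊥`, so the next edge returns to `i`.
  have start : ∀ a, (∀ b, a = b + 1 → p b ∈ A.exitsR ++ A.exitsL) → p a = i.1 := by
    intro a
    induction a using Nat.strong_induction_on with
    | _ a ih =>
      intro ha
      cases a with
      | zero => exact hp.start
      | succ e =>
        have he := ha e rfl
        have hcut : ∃ b ≤ e, (∀ b', b = b' + 1 → p b' ∈ A.exitsR ++ A.exitsL) ∧
            ∀ k, b ≤ k → k < e → p k ∉ A.exitsR ++ A.exitsL := by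
          clear ih ha he
          induction e with
          | zero => exact ⟨0, le_rfl, fun b' h => by omega, fun k _ h => by omega⟩
          | succ e ih =>
            by_cases h : p e ∈ A.exitsR ++ A.exitsL
            · refine ⟨e + 1, le_rfl, fun b' hb' => ?_, fun k _ h => by omega⟩
              obtain rfl : e = b' := by omega
              exact h
            · obtain ⟨b, hb, h₁, h₂⟩ := ih
              refine ⟨b, by omega, h₁, fun k hk hke => ?_⟩
              rcases (Nat.lt_succ_iff_lt_or_eq).1 hke with h' | rfl
              · exact h₂ k hk h'
              · exact h
        obtain ⟨b, hbe, hb, hlt⟩ := hcut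
        obtain ⟨c, hc, -⟩ := segment b e hbe (ih b (by omega) hb) hb he hlt
        exact (loop_edge_of_some he hc).1 (hp.edge e)
  by_cases hfreq : ∃ᶠ n in atTop, p n ∈ A.exitsR ++ A.exitsL
  · obtain ⟨m, hm⟩ := Priority.exists_isGreatest_frequently
      fun n => (A.loop i q).prio (p n) (p (n + 1))
    refine ⟨m, ?_, hm⟩
    refine Priority.limsup_of_segments (Q := fun m => Even m.val) hfreq ?_ hm
    rintro a e hae ha he hlt m hle ⟨k, hak, hke, hk⟩
    obtain ⟨c, hc, hev⟩ := segment a e hae (start a ha) ha he hlt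
    rw [← eq_max_of_segment (m := m)] at hev
    · exact hev
    · exact fun k hk => hle (a + k) (by omega) (by omega)
    · exact (loop_prio_of_some he hc).symm.trans_le (hle e hae le_rfl)
    · rcases hke.lt_or_eq with h | rfl
      · exact Or.inl ⟨k - a, by omega, by rw [Nat.add_sub_cancel' hak]; exact hk⟩
      · exact Or.inr ((loop_prio_of_some he hc).symm.trans hk)
  · have hbdd : ∃ N, ∀ n ≥ N, p n ∉ A.exitsR ++ A.exitsL := by
      rw [← eventually_atTop]
      exact not_frequently.1 hfreq
    -- The least bound is `0` or comes right after an exit, so the exit-free tail is a full play of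
    -- `A` from `i`.
    have ha : ∀ b, Nat.find hbdd = b + 1 → p b ∈ A.exitsR ++ A.exitsL := by
      intro b hb
      by_contra hx
      refine Nat.find_min hbdd (m := b) (by omega) fun n hn => ?_
      rcases hn.lt_or_eq with h | rfl
      · exact Nat.find_spec hbdd n (by omega)
      · exact hx
    have hno := Nat.find_spec hbdd
    generalize Nat.find hbdd = a at ha hno
    have hplay := isPlay_segment hp (start a ha) ha (f := id) rfl
      fun k => Or.inl ⟨rfl, rfl, fun l _ => hno _ (by omega)⟩
    have hpar := (aboveDual_iff_of_forall_notMem fun j => hno _ (by omega)).1 (hσ _ hplay)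
    refine (parityCondition_congr a 0 fun n => ?_).2 hpar
    rw [loop_prio_of_notMem (hno _ (by omega))]
    simp only [id, Nat.add_zero, Nat.add_comm n a]
    rfl

/-! ### From the loop construction to the open game -/

open Classical in
/-- The `∃`-strategy in `A` that plays as `σ` does after the history `h`. -/
noncomputable def residual {i : A.Entrance} {q : A.Query} (σ : (A.loop i q).ExistsStrategy)
    (h : List V) : A.ExistsStrategy where
  next h' v := if v ∈ A.exitsR ++ A.exitsL then v else σ.next (h ++ h') v
  legal h' v hv := by
    split_ifs with hx
    · exact edge_exit hx
    · have := σ.legal (h ++ h') v hv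
      rwa [loop_edge_of_notMem hx] at this

/-- The node `v` is an exit from which the loop construction returns to the entrance. -/
def Returns (A : OpenParityGame V M) (q : A.Query) (v : V) : Prop :=
  ∃ (h : v ∈ A.exitsR ++ A.exitsL) (c : Priority M), q ⟨v, h⟩ = some c

open Classical in
/-- The states (history before the current segment, position in the segment) of the play in the
loop construction that follows the play `P h` of `A` after the history `h`, until it returns. -/
noncomputable def concatState (A : OpenParityGame V M) (q : A.Query) (P : List V → ℕ → V) :
    ℕ → List V × ℕ
  | 0 => ([], 0)
  | n + 1 =>
    let s := concatState A q P n
    if A.Returns q (P s.1 s.2) then (s.1 ++ (List.range (s.2 + 1)).map (P s.1), 0)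
    else (s.1, s.2 + 1)

/-- The concatenation of the plays `P h`. -/
noncomputable def concatPlay (A : OpenParityGame V M) (q : A.Query) (P : List V → ℕ → V) (n : ℕ) :
    V :=
  P (concatState A q P n).1 (concatState A q P n).2

section Concat

variable {q : A.Query} {P : List V → ℕ → V}

theorem concatState_succ_of_returns {n : ℕ} (h : A.Returns q (concatPlay A q P n)) :
    concatState A q P (n + 1) = ((concatState A q P n).1 ++
      (List.range ((concatState A q P n).2 + 1)).map (P (concatState A q P n).1), 0) := by
  rw [concatState]
  exact if_pos h

theorem concatState_succ_of_not_returns {n : ℕ} (h : ¬ A.Returns q (concatPlay A q P n)) :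
    concatState A q P (n + 1) = ((concatState A q P n).1, (concatState A q P n).2 + 1) := by
  rw [concatState]
  exact if_neg h

/-- This makes the moves of `residual` on the current segment those of `σ` on the whole history. -/
theorem concatState_history (n : ℕ) :
    (concatState A q P n).1 ++ (List.range (concatState A q P n).2).map
      (P (concatState A q P n).1) = (List.range n).map (concatPlay A q P) := by
  induction n with
  | zero => rfl
  | succ n ih =>
    have : (concatState A q P n).1 ++ (List.range ((concatState A q P n).2 + 1)).map
        (P (concatState A q P n).1) = (List.range (n + 1)).map (concatPlay A q P) := by
      rw [List.range_succ, List.map_append, ← List.append_assoc, ih, List.range_succ,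
        List.map_append]
      rfl
    by_cases h : A.Returns q (concatPlay A q P n)
    · rw [concatState_succ_of_returns h, ← this]
      simp
    · rw [concatState_succ_of_not_returns h, ← this]

theorem concatState_add {n : ℕ} (t : ℕ) (h : ∀ k < t, ¬ A.Returns q (concatPlay A q P (n + k))) :
    concatState A q P (n + t) = ((concatState A q P n).1, (concatState A q P n).2 + t) := by
  induction t with
  | zero => rfl
  | succ t ih =>
    rw [← Nat.add_assoc, concatState_succ_of_not_returns (h t (Nat.lt_succ_self t)),
      ih fun k hk => h k (by omega)]
    rfl

open Classical in
-- At an exit the outgoing edge is unique, so legality alone fixes the move of `σ`; elsewhere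
-- `concatState_history` applies.
theorem isPlay_concatPlay {i : A.Entrance} {σ : (A.loop i q).ExistsStrategy}
    (hP : ∀ h, A.IsPlay (residual σ h) i.1 (P h)) :
    (A.loop i q).IsPlay σ i.1 (concatPlay A q P) := by
  have hedge : ∀ n, (A.loop i q).edge (concatPlay A q P n) (concatPlay A q P (n + 1)) := by
    intro n
    by_cases h : A.Returns q (concatPlay A q P n)
    · have ⟨hx, c, hc⟩ := h
      rw [loop_edge_of_some hx hc]
      conv_lhs => rw [concatPlay, concatState_succ_of_returns h]
      exact (hP _).start
    · have hA := (hP (concatState A q P n).1).edge (concatState A q P n).2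
      have hs : concatPlay A q P (n + 1) =
          P (concatState A q P n).1 ((concatState A q P n).2 + 1) := by
        rw [concatPlay, concatState_succ_of_not_returns h]
      rw [hs]
      by_cases hx : concatPlay A q P n ∈ A.exitsR ++ A.exitsL
      · cases hc : q ⟨_, hx⟩ with
        | some c => exact absurd ⟨hx, c, hc⟩ h
        | none =>
          rw [loop_edge_of_none hx hc]
          exact (A.exits_sink _ hx _ hA).1
      · rw [loop_edge_of_notMem hx]
        exact hA
  refine ⟨(hP _).start, hedge, fun n hn => ?_⟩
  by_cases hx : concatPlay A q P n ∈ A.exitsR ++ A.exitsL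
  · have hσ := σ.legal ((List.range n).map (concatPlay A q P)) _ hn
    have he := hedge n
    cases hc : q ⟨_, hx⟩ with
    | some c =>
      rw [loop_edge_of_some hx hc] at hσ he
      rw [hσ, he]
    | none =>
      rw [loop_edge_of_none hx hc] at hσ he
      rw [hσ, he]
  · have hr : ¬ A.Returns q (concatPlay A q P n) := fun ⟨h, _⟩ => hx h
    have hs : concatPlay A q P (n + 1) =
        P (concatState A q P n).1 ((concatState A q P n).2 + 1) := by
      rw [concatPlay, concatState_succ_of_not_returns hr]
    have hnext := (hP (concatState A q P n).1).next (concatState A q P n).2 hn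
    rw [residual] at hnext
    change _ = if concatPlay A q P n ∈ A.exitsR ++ A.exitsL then _ else _ at hnext
    rw [if_neg hx, concatState_history] at hnext
    rw [hs, hnext]
    rfl

end Concat

theorem eq_of_exit {p : ℕ → V} (hp : ∀ n, A.edge (p n) (p (n + 1))) {j : ℕ}
    (hj : p j ∈ A.exitsR ++ A.exitsL) (k : ℕ) : p (j + k) = p j := by
  induction k with
  | zero => rfl
  | succ k ih =>
    have := hp (j + k)
    rw [ih] at this
    exact (A.exits_sink _ hj _ this).1

theorem upperLE_of_winning_loop (hM : Even M) (hM2 : 2 ≤ M) {i : A.Entrance} {q : A.Query}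
    (hw : (A.loop i q).Winning i.1) :
    ∃ σ : A.ExistsStrategy, upperLE (A.dualQuery hM q) (A.outcomes i.1 σ) := by
  classical
  obtain ⟨σ, hσ⟩ := winning_iff.1 hw
  by_contra hno
  have hbad : ∀ h, ∃ p, A.IsPlay (residual σ h) i.1 p ∧ ¬ A.AboveDual hM q p := by
    intro h
    by_contra hc
    push Not at hc
    exact hno ⟨residual σ h, upperLE_outcomes_iff.2 hc⟩
  choose P hP hPbad using hbad
  have hpar := hσ _ (isPlay_concatPlay hP)
  set p := concatPlay A q P with hp
  have hsnd : ∀ a, (∀ b, a = b + 1 → A.Returns q (p b)) → (concatState A q P a).2 = 0 := by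
    intro a ha
    cases a with
    | zero => rfl
    | succ b => rw [concatState_succ_of_returns (ha b rfl)]
  have hfollow : ∀ a, (∀ b, a = b + 1 → A.Returns q (p b)) → ∀ t,
      (∀ k < t, ¬ A.Returns q (p (a + k))) → p (a + t) = P (concatState A q P a).1 t := by
    intro a ha t ht
    rw [hp, concatPlay, concatState_add t ht, hsnd a ha, Nat.zero_add]
  by_cases hfreq : ∃ᶠ n in atTop, A.Returns q (p n)
  · obtain ⟨m, hev, hm⟩ := hpar
    refine Priority.limsup_of_segments (Q := fun m => ¬ Even m.val) hfreq ?_ hm hev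
    rintro a e hae ha he hlt m hle ⟨k, hak, hke, hk⟩ hev
    obtain ⟨j, rfl⟩ := Nat.exists_eq_add_of_le hae
    have hf : ∀ t ≤ j, p (a + t) = P (concatState A q P a).1 t := fun t ht =>
      hfollow a ha t fun k hk => hlt _ (by omega) (by omega)
    generalize (concatState A q P a).1 = h at hf
    obtain ⟨hx, c, hc⟩ := he
    -- A play of `A` stays at its first exit, so reaching one before `j` would force an earlier
    -- return.
    have hlt' : ∀ k < j, P h k ∉ A.exitsR ++ A.exitsL := by
      intro k hk hkx
      refine hlt (a + k) (by omega) (by omega) ?_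
      have h₁ := hf j le_rfl
      rw [← Nat.add_sub_cancel' hk.le, eq_of_exit (hP h).edge hkx,
        Nat.add_sub_cancel' hk.le, ← hf k hk.le] at h₁
      rw [← h₁]
      exact ⟨hx, c, hc⟩
    have hj : P h j ∈ A.exitsR ++ A.exitsL := hf j le_rfl ▸ hx
    have hcj : q ⟨P h j, hj⟩ = some c := by
      rw [← hc]
      congr 2
      exact (hf j le_rfl).symm
    have hprio : ∀ k < j, (A.loop i q).prio (p (a + k)) (p (a + k + 1)) =
        A.prio (P h k) (P h (k + 1)) := by
      intro k hk
      rw [hf k hk.le, Nat.add_assoc, hf (k + 1) hk, loop_prio_of_notMem (hlt' k hk)]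
    refine hPbad h ((aboveDual_iff_of_first hj hlt').2 ⟨c, hcj, ?_⟩)
    rw [← eq_max_of_segment (m := m)]
    · exact hev
    · exact fun k hk => hprio k hk ▸ hle (a + k) (by omega) (by omega)
    · exact (loop_prio_of_some hx hc).symm.trans_le (hle (a + j) hae le_rfl)
    · rcases hke.lt_or_eq with h' | rfl
      · refine Or.inl ⟨k - a, by omega, ?_⟩
        rw [← hprio _ (by omega), Nat.add_sub_cancel' hak]
        exact hk
      · exact Or.inr ((loop_prio_of_some hx hc).symm.trans hk)
  · have hbdd : ∃ N, ∀ n ≥ N, ¬ A.Returns q (p n) := by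
      rw [← eventually_atTop]
      exact not_frequently.1 hfreq
    have ha : ∀ b, Nat.find hbdd = b + 1 → A.Returns q (p b) := by
      intro b hb
      by_contra hx
      refine Nat.find_min hbdd (m := b) (by omega) fun n hn => ?_
      rcases hn.lt_or_eq with h | rfl
      · exact Nat.find_spec hbdd n (by omega)
      · exact hx
    have hnr := Nat.find_spec hbdd
    generalize Nat.find hbdd = a at ha hnr
    have hf : ∀ t, p (a + t) = P (concatState A q P a).1 t := fun t =>
      hfollow a ha t fun k _ => hnr _ (by omega)
    generalize (concatState A q P a).1 = h at hf
    -- The tail follows the single bad play `P h`: it is either stuck at an exit with value `⊥`, or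
    -- exit-free and hence violates parity.
    by_cases hex : ∃ j, P h j ∈ A.exitsR ++ A.exitsL
    · obtain ⟨j, hj⟩ := hex
      have hpj : ∀ n, n ≥ a + j → p n = P h j := by
        intro n hn
        obtain ⟨t, rfl⟩ := Nat.exists_eq_add_of_le hn
        rw [Nat.add_assoc, hf, eq_of_exit (hP h).edge hj]
      have hc : q ⟨P h j, hj⟩ = none := by
        by_contra hc
        obtain ⟨c, hc⟩ := Option.ne_none_iff_exists'.1 hc
        apply hnr (a + j) (by omega)
        rw [hpj _ le_rfl]
        exact ⟨hj, c, hc⟩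
      obtain ⟨m, hev, hm, -⟩ := hpar
      obtain ⟨n, hn, hnm⟩ := frequently_atTop.1 hm (a + j)
      rw [hpj n hn, loop_prio_of_none hj hc] at hnm
      -- The loop priority `1` is odd only because `M > 0`; in `Fin 1` it would equal `0`.
      rw [← hnm, Fin.val_one', Nat.mod_eq_of_lt (by omega)] at hev
      exact Nat.not_even_one hev
    · push Not at hex
      refine hPbad h ((aboveDual_iff_of_forall_notMem hex).2 ?_)
      refine (parityCondition_congr a 0 fun n => ?_).1 hpar
      rw [Nat.add_comm n a, Nat.add_assoc, hf, hf, loop_prio_of_notMem (hex n)]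
      rfl

/-! ### The Pareto front -/

theorem outcomes_nonempty (v : V) (σ : A.ExistsStrategy) : (A.outcomes v σ).Nonempty := by
  obtain ⟨τ⟩ := A.nonempty_forallStrategy
  exact ⟨_, τ, rfl⟩

theorem isResult_of_mem_paretoFront [Finite V] {i : A.Entrance} {r : Set (Denotation A.Exit M)}
    (hr : r ∈ A.paretoFront i) : IsResult r := by
  obtain ⟨σ, rfl⟩ := hr.1
  exact isResult_worst (outcomes_nonempty _ _)

theorem winning_loop_iff_exists_mem_paretoFront [Finite V] (hM : Even M) (hM2 : 2 ≤ M)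
    (i : A.Entrance) (q : A.Query) :
    (A.loop i q).Winning i.1 ↔
      ∃ r ∈ A.paretoFront i, upperLE (A.dualQuery hM q) r := by
  constructor
  · intro hw
    obtain ⟨σ, hσ⟩ := upperLE_of_winning_loop hM hM2 hw
    obtain ⟨r, hr, hle⟩ := exists_mem_maximalElems (r := upperLE) upperLE_refl upperLE_trans
      (T := {T | ∃ σ : A.ExistsStrategy, T = worst (A.outcomes i.1 σ)}) ⟨σ, rfl⟩
    exact ⟨r, hr, upperLE_trans _ _ _ (upperLE_worst_iff.2 hσ) hle⟩
  · rintro ⟨r, hr, hle⟩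
    obtain ⟨σ, rfl⟩ := hr.1
    exact winning_loop_of_upperLE (upperLE_worst_iff.1 hle)

theorem isMinimalWinningQuery_iff [Finite V] (hM : Even M) (hM2 : 2 ≤ M) (i : A.Entrance)
    (q : A.Query) : A.IsMinimalWinningQuery i q ↔ A.dualQuery hM q ∈ A.paretoFront i := by
  constructor
  · rintro ⟨hw, hmin⟩
    obtain ⟨r, hr, hle⟩ := (winning_loop_iff_exists_mem_paretoFront hM hM2 i q).1 hw
    -- No element of a dual lies below `⊥`, so `r` omits `⊥` and is itself a dual.
    obtain ⟨q', rfl⟩ := exists_dualQuery_eq hM (isResult_of_mem_paretoFront hr)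
      fun h => not_exists_dualQuery_domLE_bot hM q (hle _ h)
    have hq := (upperLE_dualQuery_iff hM).1 hle
    have hw' := (winning_loop_iff_exists_mem_paretoFront hM hM2 i q').2 ⟨_, hr, upperLE_refl _⟩
    rwa [queryLE_antisymm (hmin q' hw' hq) hq]
  · intro hq
    refine ⟨(winning_loop_iff_exists_mem_paretoFront hM hM2 i q).2 ⟨_, hq, upperLE_refl _⟩, ?_⟩
    intro q' hw' hle
    obtain ⟨r, hr, hle'⟩ := (winning_loop_iff_exists_mem_paretoFront hM hM2 i q').1 hw'
    have hqr := upperLE_trans _ _ _ ((upperLE_dualQuery_iff hM).2 hle) hle'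
    exact (upperLE_dualQuery_iff hM).1 (upperLE_trans _ _ _ hle' (hq.2 r hr.1 hqr))

end OpenParityGame

theorem mainTheorem2 {V : Type*} [Finite V] {M : ℕ} (hM : Even M) (hM2 : 2 ≤ M)
    (A : OpenParityGame V M) (i : A.Entrance) (q : A.Query) :
    (A.IsMinimalWinningQuery i q ↔ A.dualQuery hM q ∈ A.paretoFront i) ∧
    ((A.loop i q).Winning i.1 ↔
      ∃ r : Set (Denotation A.Exit M), Denotation.IsResult r ∧
        Denotation.upperLE (A.dualQuery hM q) r ∧ r ∈ A.paretoFront i) := by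
  refine ⟨OpenParityGame.isMinimalWinningQuery_iff hM hM2 i q, ?_⟩
  rw [OpenParityGame.winning_loop_iff_exists_mem_paretoFront hM hM2]
  exact exists_congr fun r => ⟨fun ⟨hr, hle⟩ =>
    ⟨OpenParityGame.isResult_of_mem_paretoFront hr, hle, hr⟩, fun ⟨_, hle, hr⟩ => ⟨hr, hle⟩⟩
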